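/- Let $\mathsf{GLP}$ be the propositional normal modal logic with a modality $[\alpha]$ for every ordinal $\alpha$, axiomatized by all propositional tautologies, the schemata $[\alpha](\chi\to\psi)\to([\alpha]\chi\to[\alpha]\psi)$; $[\alpha]([\alpha]\chi\to\chi)\to[\alpha]\chi$; $\langle\alpha\rangle\psi\to[\beta]\langle\alpha\rangle\psi$ for $\alpha<\beta$; $[\alpha]\psi\to[\beta]\psi$ for $\alpha\le\beta$; and the rules of modus ponens and necessitation. A worm is a formula $\langle\alpha_1\rangle\cdots\langle\alpha_n\rangle\top$ with $n\ge 0$, identified with the string $\alpha_1\dots\alpha_n$ of ordinals; $\xi\in A$ means that $\xi$ occurs in the worm $A$, and $S_\alpha$ is the class of worms all of whose modalities are at least $\alpha$. For worms $A,B$ put $A<_\alpha B$ iff $\mathsf{GLP}\vdash B\to\langle\alpha\rangle A$, and $A\le_\alpha B$ iff $A<_\alpha B$ or $\mathsf{GLP}\vdash A\leftrightarrow B$. A worm $A$ is in Beklemishev normal form if it is empty, or $A=A_k\alpha A_{k-1}\alpha\cdots\alpha A_1$ with $k\ge1$, where $\alpha=\min(A)$, each $A_i\in S_{\alpha+1}$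 is in Beklemishev normal form, and $A_{i+1}\le_{\alpha+1}A_i$ for all $i<k$. The class of such worms is $\mathcal B$. The $\xi$-head $h_\xi(A)$ is the longest initial segment of $A$ all of whose modalities are at least $\xi$. If $\alpha=\omega^{\alpha_1}+\dots+\omega^{\alpha_n}$ with $\alpha_1\ge\dots\ge\alpha_n$ is the Cantor normal form of $\alpha$, let $\mathsf{CNA}(\alpha)=\{\omega^{\alpha_1}+\dots+\omega^{\alpha_k}: 0\le k\le n\}$. Then for every ordinal $\xi$ the relation $<_\xi$ on the class of all worms is well-founded, so that ordinals $\Omega_\xi(A)$ are well defined by the recursion $\Omega_\xi(A)=\sup_{B<_\xi A}(\Omega_\xi(B)+1)$, with $B$ ranging over all worms. Write $\mathsf{Change}(\zeta,A)$ if there is $\xi<\zeta$ such that $\Omega_\xi(A)>\Omega_\zeta(A)$ and $\Omega_\xi(A)=\Omega_\eta(A)$ for all $\eta$ with $\xi\le\eta<\zeta$. For every limit ordinal $\zeta>0$ and every worm $A\in\mathcal B$, $$\mathsf{Change}(\zeta,A)\iff \text{there is }\xi\in h_\zeta(A)\text{ with }\zeta\in\mathsf{CNA}(\xi).$$ -/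

import Mathlib

universe u

namespace GLP

/-- Formulas of the polymodal language with one modality `[α]` for every ordinal `α`. -/
inductive Formula : Type (u + 1) where
  | var : ℕ → Formula
  | bot : Formula
  | imp : Formula → Formula → Formula
  | box : Ordinal.{u} → Formula → Formula

namespace Formula

def neg (φ : Formula.{u}) : Formula.{u} := imp φ bot

def top : Formula.{u} := neg bot

/-- `⟨α⟩φ`, the dual of `[α]φ`. -/
def dia (α : Ordinal.{u}) (φ : Formula.{u}) : Formula.{u} := neg (box α (neg φ))

/-- Truth of a formula under a Boolean valuation that treats variables and boxed formulas
as atoms. -/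
def eval (v : Formula.{u} → Prop) : Formula.{u} → Prop
  | var n => v (var n)
  | bot => False
  | imp φ ψ => eval v φ → eval v ψ
  | box α φ => v (box α φ)

/-- Propositional tautologies of the modal language. -/
def IsTautology (φ : Formula.{u}) : Prop := ∀ v : Formula.{u} → Prop, eval v φ

end Formula

open Formula in
/-- Theorems of the logic `GLP` (with a modality for each ordinal). -/
inductive Provable : Formula.{u} → Prop where
  | taut (φ : Formula.{u}) : IsTautology φ → Provable φ
  | distrib (α : Ordinal.{u}) (χ ψ : Formula.{u}) :
      Provable (imp (box α (imp χ ψ)) (imp (box α χ) (box α ψ)))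
  | loeb (α : Ordinal.{u}) (χ : Formula.{u}) :
      Provable (imp (box α (imp (box α χ) χ)) (box α χ))
  | negIntro (α β : Ordinal.{u}) (ψ : Formula.{u}) : α < β →
      Provable (imp (dia α ψ) (box β (dia α ψ)))
  | monotone (α β : Ordinal.{u}) (ψ : Formula.{u}) : α ≤ β →
      Provable (imp (box α ψ) (box β ψ))
  | mp (φ ψ : Formula.{u}) : Provable (imp φ ψ) → Provable φ → Provable ψ
  | nec (α : Ordinal.{u}) (φ : Formula.{u}) : Provable φ → Provable (box α φ)

/-- Worms, identified with finite strings of ordinals: the string `α₁ … αₙ` stands for the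
formula `⟨α₁⟩ … ⟨αₙ⟩⊤`. -/
abbrev Worm : Type (u + 1) := List Ordinal.{u}

namespace Worm

def toFormula : Worm.{u} → Formula.{u}
  | [] => Formula.top
  | α :: A => Formula.dia α (toFormula A)

/-- The class `S_α` of worms all of whose modalities are at least `α`. -/
def S (α : Ordinal.{u}) : Set Worm.{u} := {A | ∀ β ∈ A, α ≤ β}

/-- `A <_α B`, that is `GLP ⊢ B → ⟨α⟩A`, on the class of all worms. -/
def lt (α : Ordinal.{u}) (A B : Worm.{u}) : Prop :=
  Provable (Formula.imp (toFormula B) (Formula.dia α (toFormula A)))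

/-- Provable equivalence of worms. -/
def equiv (A B : Worm.{u}) : Prop :=
  Provable (Formula.imp (toFormula A) (toFormula B)) ∧
    Provable (Formula.imp (toFormula B) (toFormula A))

/-- `A ≤_α B`: the order `<_α` or provable equivalence. -/
def le (α : Ordinal.{u}) (A B : Worm.{u}) : Prop := lt α A B ∨ equiv A B

/-- Beklemishev normal form: the empty worm, or `A_k α … α A_1` where `α` is the least modality
of the whole worm, each `A_i` lies in `S_{α+1}` and is in normal form, and
`A_{i+1} ≤_{α+1} A_i`. The list `L` is `[A_k, …, A_1]`. -/
inductive IsBNF : Worm.{u} → Prop where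
  | nil : IsBNF []
  | join (α : Ordinal.{u}) (L : List Worm.{u}) :
      L ≠ [] →
      IsLeast {β | β ∈ List.intercalate [α] L} α →
      (∀ X ∈ L, X ∈ S (α + 1)) →
      (∀ X ∈ L, IsBNF X) →
      List.IsChain (le (α + 1)) L →
      IsBNF (List.intercalate [α] L)

/-- The `ξ`-head: the largest initial part all of whose modalities are at least `ξ`. -/
noncomputable def head (ξ : Ordinal.{u}) (A : Worm.{u}) : Worm.{u} :=
  A.takeWhile (fun η => decide (ξ ≤ η))

open Classical in
/-- `Ω_ξ(A)`, the rank of `A` in the relation `<_ξ` on all worms. The default value is irrelevant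
as soon as `<_ξ` is well-founded. The rank is taken in the universe of the type of all worms, so
that the supremum over all worms below `A` is a genuine one. -/
noncomputable def Omega (ξ : Ordinal.{u}) (A : Worm.{u}) : Ordinal.{u + 1} :=
  if h : Acc (lt ξ) A then h.rank else 0

/-- The recursion `Ω_ξ(A) = sup {Ω_ξ(B) + 1 | B <_ξ A}`. -/
theorem isLUB_Omega {ξ : Ordinal.{u}} (hwf : WellFounded (lt ξ)) (A : Worm.{u}) :
    IsLUB {o | ∃ B, lt ξ B A ∧ o = Omega ξ B + 1} (Omega ξ A) := by
  have key : ∀ B, Omega ξ B = (hwf.apply B).rank := fun B => dif_pos (hwf.apply B)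
  constructor
  · rintro _ ⟨B, hB, rfl⟩
    rw [key, key, ← Order.succ_eq_add_one, Order.succ_le_iff]
    exact Acc.rank_lt_of_rel (hwf.apply A) hB
  · intro o ho
    rw [key, Acc.rank_eq]
    refine Ordinal.iSup_le fun b => ?_
    have := ho ⟨b.1, b.2, rfl⟩
    rw [key] at this
    exact this

/-- The sequence `⟨Ω_ξ(A)⟩` changes value at the coordinate `ζ`. -/
def Change (ζ : Ordinal.{u}) (A : Worm.{u}) : Prop :=
  ∃ ξ < ζ, Omega ξ A > Omega ζ A ∧ ∀ η, ξ ≤ η → η < ζ → Omega ξ A = Omega η A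

end Worm

/-- The ordinal `ω ^ ξ₁ + ⋯ + ω ^ ξₙ`. -/
noncomputable def sumOmegaPow (L : List Ordinal.{u}) : Ordinal.{u} :=
  (L.map (fun ξ => Ordinal.omega0 ^ ξ)).sum

/-- `L = [ξ₁, …, ξₙ]` is the list of exponents of the Cantor normal form
`α = ω ^ ξ₁ + ⋯ + ω ^ ξₙ` with `ξ₁ ≥ … ≥ ξₙ`. -/
def IsCNF (L : List Ordinal.{u}) (α : Ordinal.{u}) : Prop :=
  L.Pairwise (· ≥ ·) ∧ sumOmegaPow L = α

/-- The partial sums of the Cantor normal form of `α`, including `0` and `α`. -/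
def CNA (α : Ordinal.{u}) : Set Ordinal.{u} :=
  {σ | ∃ L, IsCNF L α ∧ ∃ k ≤ L.length, σ = sumOmegaPow (L.take k)}

end GLP

/-! Subtracting `ξ` from the letters of the `ξ`-head gives `Ω_ξ(A) = Ω_0(lowerHead ξ A)`
(`Omega_eq_Omega_lowerHead`). Write the limit `ζ` as `ζ₀ + ω^ρ`, with `ω^ρ` its last Cantor summand.
For `ξ < ζ` close to `ζ` the `ξ`-head is the `ζ`-head and `ξ + ω^ρ = ζ`, so `lowerHead ξ A` is
`lowerHead ζ A` with `ω^ρ` added on the left of each letter (`exists_lowerHead`). A change at `ζ`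
thus means that this addition alters the rank.

A letter `ζ + δ` of the head satisfies `ζ ∈ CNA (ζ + δ)` iff `δ < ω^(ρ+1)`, that is, iff `ω^ρ + δ ≠
δ`. If no letter does, the two worms coincide. If some letter does, the least letter strictly rises;
equal ranks would make the worms equivalent by linearity (`trichotomy`), which is impossible for a
normal form (`IsBNF.not_equiv`).

Well-foundedness rests on irreflexivity, i.e. consistency of worms, proved with Kripke models for
finitely many modalities, and on a minimal bad sequence argument (`partiallyWellOrderedOn_le`). -/

namespace GLP

/-! ### Derivations in GLP and renaming of modalities. -/

namespace Formula

/-- Conjunction. -/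
def conj (φ ψ : Formula.{u}) : Formula.{u} := neg (imp φ (neg ψ))

end Formula

open Formula

section Logic

variable {φ ψ χ : Formula.{u}} {α β : Ordinal.{u}}

theorem Provable.imp_refl (φ : Formula.{u}) : Provable (imp φ φ) :=
  .taut _ fun v => by simp [eval]

theorem Provable.imp_trans (h₁ : Provable (imp φ ψ)) (h₂ : Provable (imp ψ χ)) :
    Provable (imp φ χ) :=
  .mp _ _ (.mp _ _ (.taut (imp (imp φ ψ) (imp (imp ψ χ) (imp φ χ)))
    fun v => by simp only [eval]; tauto) h₁) h₂

theorem Provable.imp_top (φ : Formula.{u}) : Provable (imp φ top) :=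
  .taut _ fun v => by simp [eval, top, neg]

theorem Provable.imp_conj (h₁ : Provable (imp φ ψ)) (h₂ : Provable (imp φ χ)) :
    Provable (imp φ (conj ψ χ)) :=
  .mp _ _ (.mp _ _ (.taut (imp (imp φ ψ) (imp (imp φ χ) (imp φ (conj ψ χ))))
    fun v => by simp only [eval, conj, neg]; tauto) h₁) h₂

theorem Provable.conj_left (φ ψ : Formula.{u}) : Provable (imp (conj φ ψ) φ) :=
  .taut _ fun v => by simp only [eval, conj, neg]; tauto

theorem Provable.conj_right (φ ψ : Formula.{u}) : Provable (imp (conj φ ψ) ψ) :=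
  .taut _ fun v => by simp only [eval, conj, neg]; tauto

theorem Provable.curry (h : Provable (imp (conj φ ψ) χ)) : Provable (imp φ (imp ψ χ)) :=
  .mp _ _ (.taut (imp (imp (conj φ ψ) χ) (imp φ (imp ψ χ)))
    fun v => by simp only [eval, conj, neg]; tauto) h

theorem Provable.contrapose (h : Provable (imp φ ψ)) : Provable (imp (neg ψ) (neg φ)) :=
  .mp _ _ (.taut (imp (imp φ ψ) (imp (neg ψ) (neg φ)))
    fun v => by simp only [eval, neg]; tauto) h

theorem Provable.not_not_intro (φ : Formula.{u}) : Provable (imp φ (neg (neg φ))) :=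
  .taut _ fun v => by simp only [eval, neg]; tauto

theorem Provable.box_mono (α : Ordinal.{u}) (h : Provable (imp φ ψ)) :
    Provable (imp (box α φ) (box α ψ)) :=
  .mp _ _ (.distrib α φ ψ) (.nec α _ h)

theorem Provable.dia_mono (α : Ordinal.{u}) (h : Provable (imp φ ψ)) :
    Provable (imp (dia α φ) (dia α ψ)) :=
  (h.contrapose.box_mono α).contrapose

/-- Transitivity of `[α]`, from Löb's axiom. -/
theorem Provable.box_box (α : Ordinal.{u}) (φ : Formula.{u}) :
    Provable (imp (box α φ) (box α (box α φ))) := by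
  -- Löb's axiom will be applied to `φ ∧ [α]φ`.
  have h : Provable (imp φ (imp (box α (conj φ (box α φ))) (conj φ (box α φ)))) :=
    .curry (.imp_conj (.conj_left _ _)
      ((Provable.conj_right _ _).imp_trans ((Provable.conj_left _ _).box_mono α)))
  exact ((h.box_mono α).imp_trans (.loeb α _)).imp_trans ((Provable.conj_right _ _).box_mono α)

theorem Provable.dia_dia (α : Ordinal.{u}) (φ : Formula.{u}) :
    Provable (imp (dia α (dia α φ)) (dia α φ)) :=
  ((Provable.box_box α (neg φ)).imp_trans ((Provable.not_not_intro _).box_mono α)).contrapose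

theorem Provable.dia_le (h : α ≤ β) (φ : Formula.{u}) : Provable (imp (dia β φ) (dia α φ)) :=
  (Provable.monotone α β (neg φ) h).contrapose

theorem Provable.dia_conj_box (α : Ordinal.{u}) (φ ψ : Formula.{u}) :
    Provable (imp (conj (dia α φ) (box α ψ)) (dia α (conj φ ψ))) := by
  have h : Provable (imp ψ (imp (neg (conj φ ψ)) (neg φ))) :=
    .taut _ fun v => by simp only [eval, conj, neg]; tauto
  have h₂ := (h.box_mono α).imp_trans (.distrib α _ _)
  exact .mp _ _ (.taut (imp (imp (box α ψ) (imp (box α (neg (conj φ ψ))) (box α (neg φ)))) _)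
    fun v => by simp only [eval, conj, neg, dia]; tauto) h₂

theorem Provable.dia_conj_dia (h : α < β) (φ ψ : Formula.{u}) :
    Provable (imp (conj (dia β φ) (dia α ψ)) (dia β (conj φ (dia α ψ)))) :=
  (Provable.imp_conj (.conj_left _ _)
    ((Provable.conj_right _ _).imp_trans (.negIntro α β ψ h))).imp_trans (.dia_conj_box β _ _)

theorem Provable.dia_dia_of_le (h : α ≤ β) (φ : Formula.{u}) :
    Provable (imp (dia β (dia α φ)) (dia α φ)) :=
  (Provable.dia_le h _).imp_trans (.dia_dia α φ)

theorem Provable.neg_of_imp_dia (h : Provable (imp φ (dia α φ))) : Provable (neg φ) := by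
  have h₁ : Provable (imp (box α (neg φ)) (neg φ)) :=
    (Provable.not_not_intro _).imp_trans h.contrapose
  exact .mp _ _ h₁ (.mp _ _ (.loeb α _) (.nec α _ h₁))

end Logic

/-- Renaming of modalities. -/
def Formula.rename (f : Ordinal.{u} → Ordinal.{u}) : Formula.{u} → Formula.{u}
  | .var n => .var n
  | .bot => .bot
  | .imp φ ψ => .imp (rename f φ) (rename f ψ)
  | .box α φ => .box (f α) (rename f φ)

theorem Formula.eval_rename (f : Ordinal.{u} → Ordinal.{u})
    (v : Formula.{u} → Prop) (φ : Formula.{u}) :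
    eval v (rename f φ) ↔ eval (fun ψ => v (rename f ψ)) φ := by
  induction φ with
  | var n => rfl
  | bot => rfl
  | imp φ ψ ih₁ ih₂ => simp only [rename, eval, ih₁, ih₂]
  | box α φ => rfl

/-- Used with `f = (ξ + ·)`, to lift facts about `<_0` to `<_ξ`. -/
theorem Provable.rename {f : Ordinal.{u} → Ordinal.{u}} (hf : StrictMono f)
    {φ : Formula.{u}} (h : Provable φ) : Provable (rename f φ) := by
  induction h with
  | taut φ h => exact .taut _ fun v => (eval_rename f v φ).2 (h _)
  | distrib α χ ψ => exact .distrib _ _ _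
  | loeb α χ => exact .loeb _ _
  | negIntro α β ψ h => exact .negIntro _ _ _ (hf h)
  | monotone α β ψ h => exact .monotone _ _ _ (hf.monotone h)
  | mp φ ψ _ _ ih₁ ih₂ => exact .mp _ _ ih₁ ih₂
  | nec α φ _ ih => exact .nec _ _ ih

/-! ### Entailment between worms. -/

namespace Worm

/-- `Entails A B` means that `GLP ⊢ A → B`. -/
def Entails (A B : Worm.{u}) : Prop := Provable (imp (toFormula A) (toFormula B))

variable {A B C h r b : Worm.{u}} {α β η : Ordinal.{u}}

theorem lt.entails (h : lt α A B) : Entails B (α :: A) := h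

theorem Entails.lt (h : Entails B (α :: A)) : lt α A B := h

theorem Entails.refl (A : Worm.{u}) : Entails A A := Provable.imp_refl _

theorem Entails.trans (h₁ : Entails A B) (h₂ : Entails B C) : Entails A C := h₁.imp_trans h₂

theorem entails_nil (A : Worm.{u}) : Entails A [] := Provable.imp_top _

theorem Entails.cons (α : Ordinal.{u}) (h : Entails A B) : Entails (α :: A) (α :: B) :=
  Provable.dia_mono α h

theorem entails_cons_of_le (h : α ≤ β) (A : Worm.{u}) : Entails (β :: A) (α :: A) :=
  Provable.dia_le h _

theorem cons_cons_entails (h : α ≤ β) (A : Worm.{u}) : Entails (β :: α :: A) (α :: A) :=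
  Provable.dia_dia_of_le h _

theorem append_entails_left (A B : Worm.{u}) : Entails (A ++ B) A := by
  induction A with
  | nil => exact entails_nil _
  | cons x A ih => exact ih.cons x

theorem append_entails_right (hh : ∀ x ∈ h, η ≤ x) (b : Worm.{u}) :
    Entails (h ++ η :: b) (η :: b) := by
  induction h with
  | nil => exact .refl _
  | cons x h ih =>
    simp only [List.mem_cons, forall_eq_or_imp] at hh
    exact ((ih hh.2).cons x).trans (cons_cons_entails hh.1 b)

/-- Since `η` lies below every letter of `h`, the conjunct `⟨η⟩b` can be pushed inside the diamonds
of `h` one at a time. -/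
theorem conj_entails_append (hh : ∀ x ∈ h, η < x) (b : Worm.{u}) :
    Provable (imp (conj (toFormula h) (toFormula (η :: b))) (toFormula (h ++ η :: b))) := by
  induction h with
  | nil => exact .conj_right _ _
  | cons x h ih =>
    simp only [List.mem_cons, forall_eq_or_imp] at hh
    exact (Provable.dia_conj_dia hh.1 _ _).imp_trans ((ih hh.2).dia_mono x)

theorem Entails.append (hh : ∀ x ∈ h, η < x) (h₁ : Entails A h) (h₂ : Entails A (η :: b)) :
    Entails A (h ++ η :: b) :=
  (Provable.imp_conj h₁ h₂).imp_trans (conj_entails_append hh b)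

theorem lt_trans (h₁ : lt α A B) (h₂ : lt α B C) : lt α A C :=
  (h₂.entails.trans ((h₁.entails.cons α).trans (cons_cons_entails le_rfl A))).lt

theorem lt_mono_modality (h₁ : α ≤ β) (h₂ : lt β A B) : lt α A B :=
  (h₂.entails.trans (entails_cons_of_le h₁ A)).lt

theorem lt_of_entails_of_lt (h₁ : Entails B A) (h₂ : lt α C A) : lt α C B :=
  (h₁.trans h₂.entails).lt

theorem lt_of_lt_of_entails (h₁ : Entails A C) (h₂ : lt α A B) : lt α C B :=
  (h₂.entails.trans (h₁.cons α)).lt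

theorem equiv.entails (h : equiv A B) : Entails A B := h.1

theorem equiv.symm (h : equiv A B) : equiv B A := ⟨h.2, h.1⟩

theorem Entails.equiv (h₁ : Entails A B) (h₂ : Entails B A) : equiv A B := ⟨h₁, h₂⟩

theorem equiv_refl (A : Worm.{u}) : equiv A A := (Entails.refl A).equiv (.refl A)

/-- If `A ≤_α B` then `⟨α⟩B` implies `⟨α⟩A`. -/
theorem cons_entails_of_le (h : le α A B) : Entails (α :: B) (α :: A) := by
  rcases h with h | h
  · exact (h.entails.cons α).trans (cons_cons_entails le_rfl A)
  · exact h.symm.entails.cons α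

theorem le_trans (h₁ : le α A B) (h₂ : le α B C) : le α A C := by
  rcases h₂ with h₂ | h₂
  · exact .inl (h₂.entails.trans (cons_entails_of_le h₁)).lt
  · rcases h₁ with h₁ | h₁
    · exact .inl (lt_of_entails_of_lt h₂.symm.entails h₁)
    · exact .inr ((h₁.entails.trans h₂.entails).equiv (h₂.symm.entails.trans h₁.symm.entails))

theorem toFormula_map (f : Ordinal.{u} → Ordinal.{u}) (A : Worm.{u}) :
    toFormula (A.map f) = rename f (toFormula A) := by
  induction A with
  | nil => rfl
  | cons x A ih => simp only [List.map_cons, toFormula, ih]; rfl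

theorem Entails.map {f : Ordinal.{u} → Ordinal.{u}} (hf : StrictMono f) (h : Entails A B) :
    Entails (A.map f) (B.map f) := by
  rw [Entails, toFormula_map, toFormula_map]
  exact Provable.rename hf h

end Worm

end GLP

/-! ### Kripke models and the consistency of worms. -/

namespace GLP

open Formula

/-- Truth of a formula at a point of a Kripke frame, with all variables false. -/
def Formula.Sat {X : Type*} (R : Ordinal.{u} → X → X → Prop) : Formula.{u} → X → Prop
  | .var _, _ => False
  | .bot, _ => False
  | .imp φ ψ, x => Sat R φ x → Sat R ψ x
  | .box α φ, x => ∀ y, R α x y → Sat R φ y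

theorem Formula.sat_dia {X : Type*} {R : Ordinal.{u} → X → X → Prop} {α : Ordinal.{u}}
    {φ : Formula.{u}} {x : X} : Sat R (dia α φ) x ↔ ∃ y, R α x y ∧ Sat R φ y := by
  simp only [dia, neg, Sat]
  simp

theorem Formula.eval_sat {X : Type*} (R : Ordinal.{u} → X → X → Prop) (x : X)
    (φ : Formula.{u}) : eval (fun ψ => Sat R ψ x) φ ↔ Sat R φ x := by
  induction φ with
  | var n => rfl
  | bot => rfl
  | imp φ ψ ih₁ ih₂ => simp only [eval, Sat, ih₁, ih₂]
  | box α φ => rfl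

/-- Kripke frames in which the axioms for modalities from `s` hold when variables are false. -/
structure IsModel (s : Set Ordinal.{u}) {X : Type*} (R : Ordinal.{u} → X → X → Prop) : Prop where
  trans : ∀ α ∈ s, ∀ x y z, R α x y → R α y z → R α x z
  wf : ∀ α ∈ s, WellFounded (Function.swap (R α))
  cross : ∀ α ∈ s, ∀ β ∈ s, α < β → ∀ x y, R β x y → ∀ z, R α x z ↔ R α y z
  mono : ∀ α ∈ s, ∀ β ∈ s, α < β → ∀ φ : Formula.{u}, ∀ x y, R β x y → Sat R φ y →
    ∃ z, R α x z ∧ Sat R φ z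

theorem IsModel.subset {s t : Set Ordinal.{u}} (h : s ⊆ t) {X : Type*}
    {R : Ordinal.{u} → X → X → Prop} (hR : IsModel t R) : IsModel s R where
  trans α hα := hR.trans α (h hα)
  wf α hα := hR.wf α (h hα)
  cross α hα β hβ := hR.cross α (h hα) β (h hβ)
  mono α hα β hβ := hR.mono α (h hα) β (h hβ)

/-- A derivation uses finitely many instances of axioms, so a frame that is good for finitely many
modalities suffices. Monotonicity is required of truth (`IsModel.mono`) and not as an inclusion of
relations, which `extRel` violates. -/
theorem Provable.sound {φ : Formula.{u}} (h : Provable φ) :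
    ∃ s : Finset Ordinal.{u}, ∀ (X : Type 1) (R : Ordinal.{u} → X → X → Prop),
      IsModel (s : Set Ordinal.{u}) R → ∀ x, Sat R φ x := by
  classical
  induction h with
  | taut φ h => exact ⟨∅, fun X R _ x => (eval_sat R x φ).1 (h _)⟩
  | distrib α χ ψ => exact ⟨∅, fun X R _ x h₁ h₂ y hy => h₁ y hy (h₂ y hy)⟩
  | loeb α χ =>
    refine ⟨{α}, fun X R hR x h₁ y => ?_⟩
    have hα : α ∈ (({α} : Finset Ordinal.{u}) : Set Ordinal.{u}) := by simp
    induction y using (hR.wf α hα).induction with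
    | _ y ih =>
      intro hy
      exact h₁ y hy fun z hz => ih z hz (hR.trans α hα _ _ _ hy hz)
  | negIntro α β ψ h =>
    refine ⟨{α, β}, fun X R hR x h₁ y hy => ?_⟩
    rw [sat_dia] at h₁ ⊢
    obtain ⟨z, hz, hψ⟩ := h₁
    exact ⟨z, (hR.cross α (by simp) β (by simp) h x y hy z).1 hz, hψ⟩
  | monotone α β ψ h =>
    refine ⟨{α, β}, fun X R hR x h₁ y hy => ?_⟩
    rcases h.eq_or_lt with rfl | h
    · exact h₁ y hy
    · by_contra hψ
      obtain ⟨z, hz, hz'⟩ := hR.mono α (by simp) β (by simp) h (neg ψ) x y hy hψ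
      exact hz' (h₁ z hz)
  | mp φ ψ _ _ ih₁ ih₂ =>
    obtain ⟨s, hs⟩ := ih₁
    obtain ⟨t, ht⟩ := ih₂
    refine ⟨s ∪ t, fun X R hR x => hs X R (hR.subset ?_) x (ht X R (hR.subset ?_) x)⟩ <;> simp
  | nec α φ _ ih =>
    obtain ⟨s, hs⟩ := ih
    exact ⟨s, fun X R hR x y _ => hs X R hR y⟩

section Extension

variable {X : Type 1} (R : Ordinal.{u} → X → X → Prop) (ρ : X → Ordinal.{0}) (a : Ordinal.{u})

/-- `α` admits the rank `r`: `r = 0`, or `α` is a nonzero multiple of `ω ^ r`. -/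
def AdmitsRank (r α : Ordinal.{0}) : Prop := r = 0 ∨ (α ≠ 0 ∧ Ordinal.omega0 ^ r ∣ α)

theorem AdmitsRank.mono {r r' α : Ordinal.{0}} (h : AdmitsRank r α) (hr : r' ≤ r) :
    AdmitsRank r' α := by
  rcases h with rfl | ⟨h₁, h₂⟩
  · exact .inl (by simpa using hr)
  · exact .inr ⟨h₁, (Ordinal.opow_dvd_opow _ hr).trans h₂⟩

/-- The witness is the first multiple of `ω^r'` above `β`; it stays below `α` because `α` is `ω^r'`
times a limit. -/
theorem AdmitsRank.exists_between {r r' α β : Ordinal.{0}} (h : AdmitsRank r α) (hr : r' < r)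
    (hβ : β < α) : ∃ γ, β < γ ∧ γ < α ∧ AdmitsRank r' γ := by
  rcases h with rfl | ⟨h₁, h₂⟩
  · simp at hr
  have hω : Ordinal.omega0.{0} ^ r' ≠ 0 := (Ordinal.opow_pos _ Ordinal.omega0_pos).ne'
  have hω' : 0 < Ordinal.omega0.{0} ^ r' := Ordinal.opow_pos _ Ordinal.omega0_pos
  obtain ⟨δ, rfl⟩ := (Ordinal.opow_dvd_opow Ordinal.omega0 (Order.succ_le_of_lt hr)).trans h₂
  rw [Ordinal.opow_succ, mul_assoc] at hβ ⊢
  have hδ : δ ≠ 0 := by rintro rfl; simp at h₁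
  refine ⟨Ordinal.omega0 ^ r' * Order.succ (β / Ordinal.omega0 ^ r'),
    Ordinal.lt_mul_succ_div _ hω, ?_, .inr ⟨?_, dvd_mul_right _ _⟩⟩
  · rw [mul_lt_mul_iff_right₀ hω']
    have hl : Order.IsSuccLimit (Ordinal.omega0 * δ) :=
      Ordinal.isSuccLimit_mul_left Ordinal.isSuccLimit_omega0 (pos_iff_ne_zero.2 hδ)
    exact hl.succ_lt ((Ordinal.lt_mul_iff_div_lt hω).1 hβ)
  · exact (mul_pos hω' (Order.bot_lt_succ _)).ne'

/-- The points of the frame extended by a new least modality. -/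
abbrev ExtPoint : Type 1 := {p : Ordinal.{0} × X // AdmitsRank (ρ p.2) p.1}

/-- The frame extended by a new least modality `a`. -/
def extRel (c : Ordinal.{u}) (p q : ExtPoint ρ) : Prop :=
  (c = a ∧ q.1.1 < p.1.1) ∨ (c ≠ a ∧ p.1.1 = q.1.1 ∧ R c p.1.2 q.1.2)

open Classical in
/-- The formula describing the truth of a formula in the fiber over `α` of the extension. -/
noncomputable def fiberFormula (α : Ordinal.{0}) : Formula.{u} → Formula.{u}
  | .var n => .var n
  | .bot => .bot
  | .imp φ ψ => .imp (fiberFormula α φ) (fiberFormula α ψ)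
  | .box c φ => if c = a then
      (if ∀ q : ExtPoint ρ, q.1.1 < α → Sat (extRel R ρ a) φ q then top else bot)
      else .box c (fiberFormula α φ)

variable {R ρ a}

theorem sat_fiberFormula (hle : ∀ c x y, R c x y → ρ y ≤ ρ x) (φ : Formula.{u})
    (p : ExtPoint ρ) :
    Sat (extRel R ρ a) φ p ↔ Sat R (fiberFormula R ρ a p.1.1 φ) p.1.2 := by
  induction φ generalizing p with
  | var n => rfl
  | bot => rfl
  | imp φ ψ ih₁ ih₂ => simp only [Sat, fiberFormula, ih₁, ih₂]
  | box c φ ih =>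
    by_cases hc : c = a
    · subst hc
      simp only [Sat, fiberFormula, if_true, extRel, true_and, ne_eq, not_true, false_and, or_false]
      split_ifs with h
      · simpa [top, neg, Sat] using h
      · simpa [Sat] using h
    · simp only [Sat, fiberFormula, extRel, hc, false_and, false_or, ne_eq,
        not_false_eq_true, true_and]
      constructor
      · intro h y hy
        have := h ⟨(p.1.1, y), p.2.mono (hle _ _ _ hy)⟩ ⟨rfl, hy⟩
        rwa [ih] at this
      · rintro h q ⟨hq₁, hq₂⟩
        rw [ih, ← hq₁]
        exact h _ hq₂

/-- Only boxes `[a]` depend on the fiber. Such a box can only turn from true to false as the fiber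
index grows, and a counterexample below `α` already lies below all `β` close to `α`. -/
theorem exists_fiberFormula_eq (φ : Formula.{u}) {α : Ordinal.{0}} (hα : 0 < α) :
    ∃ β₀ < α, ∀ β, β₀ < β → β < α →
      fiberFormula R ρ a β φ = fiberFormula R ρ a α φ := by
  induction φ with
  | var n => exact ⟨0, hα, fun _ _ _ => rfl⟩
  | bot => exact ⟨0, hα, fun _ _ _ => rfl⟩
  | imp φ ψ ih₁ ih₂ =>
    obtain ⟨β₁, h₁, h₁'⟩ := ih₁
    obtain ⟨β₂, h₂, h₂'⟩ := ih₂
    refine ⟨max β₁ β₂, max_lt h₁ h₂, fun β hβ hβ' => ?_⟩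
    rw [max_lt_iff] at hβ
    simp only [fiberFormula, h₁' β hβ.1 hβ', h₂' β hβ.2 hβ']
  | box c φ ih =>
    by_cases hc : c = a
    · simp only [fiberFormula, if_pos hc]
      by_cases h : ∀ q : ExtPoint ρ, q.1.1 < α → Sat (extRel R ρ a) φ q
      · refine ⟨0, hα, fun β _ hβ => ?_⟩
        rw [if_pos h, if_pos fun q hq => h q (hq.trans hβ)]
      · rw [if_neg h]
        push Not at h
        obtain ⟨q, hq, hq'⟩ := h
        exact ⟨q.1.1, hq, fun β hβ _ => if_neg fun h => hq' (h q hβ)⟩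
    · obtain ⟨β₁, h₁, h₁'⟩ := ih
      refine ⟨β₁, h₁, fun β hβ hβ' => ?_⟩
      simp only [fiberFormula, if_neg hc, h₁' β hβ hβ']

theorem extRel_self {p q : ExtPoint ρ} : extRel R ρ a a p q ↔ q.1.1 < p.1.1 := by
  simp [extRel]

theorem extRel_of_ne {c : Ordinal.{u}} (hc : c ≠ a) {p q : ExtPoint ρ} :
    extRel R ρ a c p q ↔ p.1.1 = q.1.1 ∧ R c p.1.2 q.1.2 := by
  simp [extRel, hc]

theorem extRel_mono_left {l : List Ordinal.{u}} (hl : l.Pairwise (· < ·))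
    (hR : IsModel {c | c ∈ l} R) (hle : ∀ c x y, R c x y → ρ y ≤ ρ x)
    (hlt : ∀ b, l.head? = some b → ∀ x y, R b x y → ρ y < ρ x)
    {c : Ordinal.{u}} (hc : c ∈ l) (hca : c ≠ a) (φ : Formula.{u}) {p q : ExtPoint ρ}
    (hpq : extRel R ρ a c p q) (hq : Sat (extRel R ρ a) φ q) :
    ∃ r, extRel R ρ a a p r ∧ Sat (extRel R ρ a) φ r := by
  rw [extRel_of_ne hca] at hpq
  rw [sat_fiberFormula hle, ← hpq.1] at hq
  -- The least modality of `l` strictly lowers `ρ`, and every other one can be traded for it by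
  -- `IsModel.mono`. The drop in rank leaves room for a fiber `γ < p.1.1`, arbitrarily close to
  -- `p.1.1`, that contains `y`.
  obtain ⟨y, hy, hyφ⟩ : ∃ y, ρ y < ρ p.1.2 ∧ Sat R (fiberFormula R ρ a p.1.1 φ) y := by
    cases l with
    | nil => simp at hc
    | cons b l =>
      rcases List.mem_cons.1 hc with rfl | hc'
      · exact ⟨_, hlt c rfl _ _ hpq.2, hq⟩
      · obtain ⟨z, hz, hzφ⟩ := hR.mono b (by simp) c hc (List.rel_of_pairwise_cons hl hc') _ _ _
          hpq.2 hq
        exact ⟨z, hlt b rfl _ _ hz, hzφ⟩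
  have hp : 0 < p.1.1 := by
    rcases p.2 with h | h
    · rw [h] at hy; simp at hy
    · exact pos_iff_ne_zero.2 h.1
  obtain ⟨β₀, hβ₀, h⟩ := exists_fiberFormula_eq (R := R) (ρ := ρ) (a := a) φ hp
  obtain ⟨γ, h₁, h₂, h₃⟩ := p.2.exists_between hy hβ₀
  refine ⟨⟨(γ, y), h₃⟩, extRel_self.2 h₂, ?_⟩
  rw [sat_fiberFormula hle]
  change Sat R (fiberFormula R ρ a γ φ) y
  rwa [h γ h₁ h₂]

theorem isModel_extRel {l : List Ordinal.{u}} (hl : l.Pairwise (· < ·)) (ha : ∀ c ∈ l, a < c)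
    (hR : IsModel {c | c ∈ l} R) (hle : ∀ c x y, R c x y → ρ y ≤ ρ x)
    (hlt : ∀ b, l.head? = some b → ∀ x y, R b x y → ρ y < ρ x) :
    IsModel {c | c ∈ a :: l} (extRel R ρ a) where
  trans c hc p q r hpq hqr := by
    rcases List.mem_cons.1 hc with rfl | hc
    · rw [extRel_self] at *
      exact hqr.trans hpq
    · rw [extRel_of_ne (ha c hc).ne'] at *
      exact ⟨hpq.1.trans hqr.1, hR.trans c hc _ _ _ hpq.2 hqr.2⟩
  wf c hc := by
    rcases List.mem_cons.1 hc with rfl | hc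
    · refine Subrelation.wf (fun {p q} h => ?_)
        (InvImage.wf (fun p : ExtPoint ρ => p.1.1) wellFounded_lt)
      exact extRel_self.1 h
    · refine Subrelation.wf (fun {p q} h => ?_)
        (InvImage.wf (fun p : ExtPoint ρ => p.1.2) (hR.wf c hc))
      exact ((extRel_of_ne (ha c hc).ne').1 h).2
  cross c hc d hd hcd p q hpq r := by
    have hd' : d ∈ l := (List.mem_cons.1 hd).resolve_left (by
      rintro rfl
      rcases List.mem_cons.1 hc with rfl | hc
      · exact hcd.false
      · exact (ha c hc).not_gt hcd)
    rw [extRel_of_ne (ha d hd').ne'] at hpq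
    rcases List.mem_cons.1 hc with rfl | hc
    · rw [extRel_self, extRel_self, hpq.1]
    · rw [extRel_of_ne (ha c hc).ne', extRel_of_ne (ha c hc).ne', hpq.1,
        hR.cross c hc d hd' hcd _ _ hpq.2]
  mono c hc d hd hcd φ p q hpq hq := by
    have hd' : d ∈ l := (List.mem_cons.1 hd).resolve_left (by
      rintro rfl
      rcases List.mem_cons.1 hc with rfl | hc
      · exact hcd.false
      · exact (ha c hc).not_gt hcd)
    rcases List.mem_cons.1 hc with rfl | hc
    · exact extRel_mono_left hl hR hle hlt hd' (ha d hd').ne' φ hpq hq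
    · rw [extRel_of_ne (ha d hd').ne'] at hpq
      rw [sat_fiberFormula hle, ← hpq.1] at hq
      obtain ⟨z, hz, hzφ⟩ := hR.mono c hc d hd' hcd _ _ _ hpq.2 hq
      refine ⟨⟨(p.1.1, z), p.2.mono (hle _ _ _ hz)⟩, ?_, ?_⟩
      · rw [extRel_of_ne (ha c hc).ne']
        exact ⟨rfl, hz⟩
      · rwa [sat_fiberFormula hle]

theorem sat_extRel_replicate_self (x : X) (n : ℕ) :
    ∀ k, (h : n ≤ k) → Sat (extRel R ρ a) (Worm.toFormula (List.replicate n a))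
      ⟨(Ordinal.omega0 ^ ρ x * ((k : Ordinal) + 1), x), .inr ⟨by simp [Ordinal.omega0_ne_zero],
        dvd_mul_right _ _⟩⟩ := by
  induction n with
  | zero => intro k _; simp [Worm.toFormula, top, neg, Sat]
  | succ n ih =>
    intro k h
    obtain ⟨k, rfl⟩ := Nat.exists_eq_add_of_le' (Nat.one_le_of_lt h)
    simp only [List.replicate_succ, Worm.toFormula]
    refine sat_dia.2 ⟨_, ?_, ih k (by omega)⟩
    rw [extRel_self]
    simp only
    rw [mul_lt_mul_iff_right₀ (Ordinal.opow_pos _ Ordinal.omega0_pos)]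
    exact_mod_cast Nat.lt_succ_self (k + 1)

theorem sat_extRel_replicate {c : Ordinal.{u}} (hc : c ≠ a)
    (hle : ∀ c x y, R c x y → ρ y ≤ ρ x) (n : ℕ) (p : ExtPoint ρ) :
    Sat (extRel R ρ a) (Worm.toFormula (List.replicate n c)) p ↔
      Sat R (Worm.toFormula (List.replicate n c)) p.1.2 := by
  have h : fiberFormula R ρ a p.1.1 (Worm.toFormula (List.replicate n c)) =
      Worm.toFormula (List.replicate n c) := by
    induction n with
    | zero => rfl
    | succ n ih => simp [List.replicate_succ, Worm.toFormula, dia, neg, fiberFormula, hc, ih]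
  rw [sat_fiberFormula hle, h]

end Extension

theorem exists_model (l : List Ordinal.{u}) (hl : l.Pairwise (· < ·)) :
    ∃ (X : Type 1) (R : Ordinal.{u} → X → X → Prop) (ρ : X → Ordinal.{0}),
      Nonempty X ∧ IsModel {c | c ∈ l} R ∧ (∀ c x y, R c x y → ρ y ≤ ρ x) ∧
      (∀ b, l.head? = some b → ∀ x y, R b x y → ρ y < ρ x) ∧
      ∀ c ∈ l, ∀ n, ∃ x, Sat R (Worm.toFormula (List.replicate n c)) x := by
  induction l with
  | nil =>
    exact ⟨PUnit, fun _ _ _ => False, fun _ => 0, ⟨⟨⟩⟩,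
      ⟨by simp, by simp, by simp, by simp⟩, by simp, by simp, by simp⟩
  | cons a l ih =>
    rw [List.pairwise_cons] at hl
    obtain ⟨X, R, ρ, ⟨x₀⟩, hR, hle, hlt, hsat⟩ := ih hl.2
    refine ⟨ExtPoint ρ, extRel R ρ a, fun p => p.1.1,
      ⟨⟨(Ordinal.omega0 ^ ρ x₀, x₀), .inr ⟨(Ordinal.opow_pos _ Ordinal.omega0_pos).ne', dvd_rfl⟩⟩⟩,
      isModel_extRel hl.2 hl.1 hR hle hlt, ?_, ?_, ?_⟩
    · rintro c p q (h | h)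
      · exact h.2.le
      · exact h.2.1.ge
    · rintro b hb p q h
      obtain rfl : a = b := by simpa using hb
      exact extRel_self.1 h
    · intro c hc n
      rcases List.mem_cons.1 hc with rfl | hc
      · exact ⟨_, sat_extRel_replicate_self x₀ n n le_rfl⟩
      · obtain ⟨x, hx⟩ := hsat c hc n
        refine ⟨⟨(Ordinal.omega0 ^ ρ x, x),
          .inr ⟨(Ordinal.opow_pos _ Ordinal.omega0_pos).ne', dvd_rfl⟩⟩, ?_⟩
        rwa [sat_extRel_replicate (hl.1 c hc).ne' hle]

namespace Worm

/-- Reduces consistency to worms with a single repeated letter, which `exists_model` satisfies. -/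
theorem replicate_entails {m : Ordinal.{u}} (A : Worm.{u}) (hA : ∀ x ∈ A, x ≤ m) :
    Entails (List.replicate A.length m) A := by
  induction A with
  | nil => exact .refl _
  | cons x A ih =>
    simp only [List.mem_cons, forall_eq_or_imp] at hA
    rw [List.length_cons, List.replicate_succ]
    exact ((ih hA.2).cons m).trans (entails_cons_of_le hA.1 A)

/-- Worms are consistent. -/
theorem not_provable_neg (A : Worm.{u}) : ¬ Provable (neg (toFormula A)) := by
  intro h
  obtain ⟨m, hm⟩ : ∃ m, ∀ x ∈ A, x ≤ m :=
    ⟨A.toFinset.sup id, fun x hx => Finset.le_sup (f := id) (List.mem_toFinset.2 hx)⟩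
  obtain ⟨s, hs⟩ := Provable.sound ((replicate_entails A hm).imp_trans h)
  obtain ⟨X, R, -, -, hR, -, -, hsat⟩ := exists_model ((insert m s).sort (· ≤ ·))
    (Finset.sortedLT_sort _).pairwise
  obtain ⟨x, hx⟩ := hsat m (by simp) A.length
  exact hs X R (hR.subset fun c hc => by simpa using .inr hc) x hx

theorem lt_irrefl (α : Ordinal.{u}) (A : Worm.{u}) : ¬ lt α A A :=
  fun h => not_provable_neg A h.neg_of_imp_dia

end Worm

end GLP

/-! ### Linearity of the worm orders. -/

namespace GLP

open Formula

namespace Worm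

variable {A B C h h' : Worm.{u}} {α β μ : Ordinal.{u}}

/-- `h` is the initial part of `A` before the first occurrence of `μ`, where `μ` is a lower bound
for the modalities of `A`. -/
def IsHead (μ : Ordinal.{u}) (h A : Worm.{u}) : Prop :=
  (∀ x ∈ h, μ < x) ∧ (A = h ∨ ∃ b, A = h ++ μ :: b)

theorem exists_isHead (hA : ∀ x ∈ A, μ ≤ x) : ∃ h, IsHead μ h A := by
  induction A with
  | nil => exact ⟨[], by simp, .inl rfl⟩
  | cons y A ih =>
    simp only [List.mem_cons, forall_eq_or_imp] at hA
    rcases hA.1.eq_or_lt with rfl | hy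
    · exact ⟨[], by simp, .inr ⟨A, rfl⟩⟩
    · obtain ⟨h, hh, h₁⟩ := ih hA.2
      refine ⟨y :: h, by simpa using ⟨hy, hh⟩, ?_⟩
      rcases h₁ with rfl | ⟨b, rfl⟩
      · exact .inl rfl
      · exact .inr ⟨b, rfl⟩

theorem IsHead.entails (hA : IsHead μ h A) : Entails A h := by
  rcases hA with ⟨-, rfl | ⟨b, rfl⟩⟩
  · exact .refl _
  · exact append_entails_left _ _

theorem exists_least (hA : A ≠ []) : ∃ μ ∈ A, ∀ x ∈ A, μ ≤ x := by
  obtain ⟨μ, h₁, h₂⟩ := A.toFinset.exists_min_image id (by simpa using hA)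
  exact ⟨μ, by simpa using h₁, fun x hx => h₂ x (by simpa using hx)⟩

/-- The worm `(μ+1) h` still has all its letters above `μ`, so `Entails.append` attaches the tail to
it. -/
theorem IsHead.lt_of_lt (hA : IsHead μ h A) (hlt : lt (μ + 1) h B)
    (ht : ∀ b, A = h ++ μ :: b → lt μ b B) : lt (μ + 1) A B := by
  rcases hA with ⟨hh, rfl | ⟨b, rfl⟩⟩
  · exact hlt
  · exact Entails.lt (Entails.append (h := (μ + 1) :: h)
      (List.forall_mem_cons.2 ⟨Order.lt_add_one_iff.2 le_rfl, hh⟩) hlt.entails (ht b rfl).entails)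

theorem IsHead.entails_of_entails (hA : IsHead μ h A) (hB : Entails B h)
    (ht : ∀ b, A = h ++ μ :: b → lt μ b B) : Entails B A := by
  rcases hA with ⟨hh, rfl | ⟨b, rfl⟩⟩
  · exact hB
  · exact Entails.append hh hB (ht b rfl).entails

theorem lt_append_of_le (hh : ∀ x ∈ h, μ < x) {b : Worm.{u}} (hb : le μ A b) :
    lt μ A (h ++ μ :: b) :=
  ((append_entails_right (fun x hx => (hh x hx).le) b).trans (cons_entails_of_le hb)).lt

/-- The worms of `S_α` are linearly ordered by `<_α` up to provable equivalence. -/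
theorem trichotomy (hA : ∀ x ∈ A, α ≤ x) (hB : ∀ x ∈ B, α ≤ x) :
    lt α A B ∨ equiv A B ∨ lt α B A := by
  induction hn : A.length + B.length using Nat.strong_induction_on generalizing A B α with
  | _ n ih =>
  subst hn
  by_cases hAB : A ++ B = []
  · obtain ⟨rfl, rfl⟩ := List.append_eq_nil_iff.1 hAB
    exact .inr (.inl (equiv_refl _))
  obtain ⟨μ, hμ, hle⟩ := exists_least hAB
  simp only [List.mem_append, or_imp, forall_and] at hle
  have hαμ : α ≤ μ := (List.mem_append.1 hμ).elim (hA μ) (hB μ)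
  suffices lt μ A B ∨ equiv A B ∨ lt μ B A from
    this.imp (lt_mono_modality hαμ) (Or.imp_right (lt_mono_modality hαμ))
  obtain ⟨h, hh⟩ := exists_isHead hle.1
  obtain ⟨h', hh'⟩ := exists_isHead hle.2
  by_contra hcon
  push Not at hcon
  obtain ⟨hAB', hne, hBA'⟩ := hcon
  -- Otherwise `B ≤_μ b` by induction, and the letter `μ` before `b` would give `B <_μ A`.
  have tA : ∀ b, A = h ++ μ :: b → lt μ b B := by
    rintro b rfl
    rcases ih (b.length + B.length) (by simp; omega) (fun x hx => hle.1 x (by simp [hx])) hle.2 rfl with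
      h₁ | h₁ | h₁
    · exact h₁
    · exact absurd (lt_append_of_le hh.1 (.inr h₁.symm)) hBA'
    · exact absurd (lt_append_of_le hh.1 (.inl h₁)) hBA'
  have tB : ∀ b, B = h' ++ μ :: b → lt μ b A := by
    rintro b rfl
    rcases ih (A.length + b.length) (by simp; omega) hle.1 (fun x hx => hle.2 x (by simp [hx])) rfl with
      h₁ | h₁ | h₁
    · exact absurd (lt_append_of_le hh'.1 (.inl h₁)) hAB'
    · exact absurd (lt_append_of_le hh'.1 (.inr h₁)) hAB'
    · exact h₁
  -- One of the two worms contains `μ`, so its head is strictly shorter; the heads can be compared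
  -- by induction in `S_{μ+1}`.
  have hlen : h.length + h'.length < A.length + B.length := by
    obtain ⟨h₁, h₁'⟩ := hh
    obtain ⟨h₂, h₂'⟩ := hh'
    rcases h₁' with rfl | ⟨b, rfl⟩ <;> rcases h₂' with rfl | ⟨b', rfl⟩
    · exact absurd ((List.mem_append.1 hμ).elim (h₁ μ) (h₂ μ)) (_root_.lt_irrefl μ)
    all_goals simp; try omega
  rcases ih _ hlen (α := μ + 1) (fun x hx => Order.add_one_le_iff.2 (hh.1 x hx))
    (fun x hx => Order.add_one_le_iff.2 (hh'.1 x hx)) rfl with h₁ | h₁ | h₁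
  · exact hAB' (lt_mono_modality (Order.le_succ μ)
      (hh.lt_of_lt (lt_of_entails_of_lt hh'.entails h₁) tA))
  · exact hne (Entails.equiv (hh'.entails_of_entails (hh.entails.trans h₁.entails) tB)
      (hh.entails_of_entails (hh'.entails.trans h₁.symm.entails) tA))
  · exact hBA' (lt_mono_modality (Order.le_succ μ)
      (hh'.lt_of_lt (lt_of_entails_of_lt hh.entails h₁) tB))

theorem not_lt_of_le (hle : le α A B) : ¬ lt α B A := by
  intro h
  rcases hle with h₁ | h₁
  · exact lt_irrefl α A (lt_trans h₁ h)
  · exact lt_irrefl α A (lt_of_lt_of_entails h₁.symm.entails h)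

theorem le_of_not_lt (hA : ∀ x ∈ A, α ≤ x) (hB : ∀ x ∈ B, α ≤ x) (h : ¬ lt α B A) : le α A B := by
  rcases trichotomy hA hB with h₁ | h₁ | h₁
  · exact .inl h₁
  · exact .inr h₁
  · exact absurd h₁ h

theorem le_of_entails (hA : ∀ x ∈ A, α ≤ x) (hB : ∀ x ∈ B, α ≤ x) (h : Entails B A) : le α A B :=
  le_of_not_lt hA hB fun h₁ => lt_irrefl α B (lt_of_entails_of_lt h h₁)

/-- The componentwise order of the decompositions `h μ b` implies the order of worms. -/
theorem append_le_append {α μ μ' : Ordinal.{u}} {h h' b b' : Worm.{u}} (hα : α ≤ μ) (hμ : μ ≤ μ')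
    (hh : ∀ x ∈ h, μ < x) (hh' : ∀ x ∈ h', μ' < x)
    (hb : ∀ x ∈ b, μ ≤ x) (hb' : ∀ x ∈ b', μ' ≤ x)
    (hle : le α h h') (hle' : le α b b') : le α (h ++ μ :: b) (h' ++ μ' :: b') := by
  -- Linearity strengthens `≤_α` to `≤_{μ+1}`: a reverse strict inequality at `μ + 1` would hold at
  -- `α` too.
  have e₁ : le (μ + 1) h h' := le_of_not_lt (fun x hx => Order.add_one_le_iff.2 (hh x hx))
    (fun x hx => Order.add_one_le_iff.2 (hμ.trans_lt (hh' x hx)))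
    fun h₁ => not_lt_of_le hle (lt_mono_modality (hα.trans (Order.le_succ μ)) h₁)
  have e₂ : le μ b b' := le_of_not_lt hb (fun x hx => hμ.trans (hb' x hx))
    fun h₁ => not_lt_of_le hle' (lt_mono_modality hα h₁)
  have t : lt μ b (h' ++ μ' :: b') :=
    ((append_entails_right (fun x hx => (hh' x hx).le) b').trans
      ((entails_cons_of_le hμ b').trans (cons_entails_of_le e₂))).lt
  have hd : IsHead μ h (h ++ μ :: b) := ⟨hh, .inr ⟨b, rfl⟩⟩
  have t' : ∀ c, h ++ μ :: b = h ++ μ :: c → lt μ c (h' ++ μ' :: b') := by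
    intro c hc
    obtain rfl : b = c := by simpa using hc
    exact t
  have hl := append_entails_left h' (μ' :: b')
  rcases e₁ with e₁ | e₁
  · exact .inl (lt_mono_modality (hα.trans (Order.le_succ μ))
      (hd.lt_of_lt (lt_of_entails_of_lt hl e₁) t'))
  · have := hd.entails_of_entails (hl.trans e₁.symm.entails) t'
    exact le_of_entails
      (by simpa [or_imp, forall_and] using ⟨fun x hx => hα.trans (hh x hx).le, hα,
        fun x hx => hα.trans (hb x hx)⟩)
      (by simpa [or_imp, forall_and] using ⟨fun x hx => (hα.trans hμ).trans (hh' x hx).le,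
        hα.trans hμ, fun x hx => (hα.trans hμ).trans (hb' x hx)⟩) this

/-! ### Well-foundedness by minimal bad sequences. -/

section WellFounded

open Set.PartiallyWellOrderedOn

/-- The components of the members of a minimal bad sequence have no bad subsequences, hence have
monotone ones. -/
theorem exists_monotone_of_isMinBadSeq {f : ℕ → Worm.{u}}
    (hf : IsBadSeq (le 0) Set.univ f) (hmin : ∀ n, IsMinBadSeq (le 0) List.length Set.univ n f)
    (p : ℕ → Worm.{u}) (hp : ∀ n, (p n).length < (f n).length) (hp' : ∀ n, le 0 (p n) (f n))
    (g : ℕ ↪o ℕ) : ∃ k : ℕ ↪o ℕ, ∀ m n, m < n → le 0 (p (g (k m))) (p (g (k n))) := by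
  have : IsTrans Worm.{u} (le 0) := ⟨fun _ _ _ => le_trans⟩
  obtain ⟨k, hk | hk⟩ := exists_increasing_or_nonincreasing_subseq (le 0) fun n => p (g n)
  · exact ⟨k, hk⟩
  exfalso
  set e : ℕ ↪o ℕ := k.trans g with he
  replace hk : ∀ m n, m < n → ¬ le 0 (p (e m)) (p (e n)) := hk
  -- Keeping `f` before `e 0` and continuing with the components gives a bad sequence whose entry at
  -- `e 0` is shorter.
  refine hmin (e 0) (fun n => if n < e 0 then f n else p (e (n - e 0)))
    (fun m hm => (if_pos hm).symm) ?_ ⟨fun _ => trivial, fun m n hmn => ?_⟩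
  · simpa using hp (e 0)
  · beta_reduce
    by_cases hn : n < e 0
    · rw [if_pos hn, if_pos (hmn.trans hn)]
      exact hf.2 m n hmn
    · rw [if_neg hn]
      by_cases hm : m < e 0
      · rw [if_pos hm]
        intro h
        exact hf.2 m (e (n - e 0)) (hm.trans_le (e.monotone (Nat.zero_le _)))
          (le_trans h (hp' _))
      · rw [if_neg hm]
        exact hk _ _ (by omega)

/-- Split each term of a minimal bad sequence at its first least letter. Along a subsequence heads
and tails are both monotone; two of the least letters there are in order, and `append_le_append`
contradicts badness. -/
theorem partiallyWellOrderedOn_le : (Set.univ : Set Worm.{u}).PartiallyWellOrderedOn (le 0) := by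
  rw [iff_not_exists_isMinBadSeq List.length]
  rintro ⟨f, hf, hmin⟩
  have hS : ∀ A : Worm.{u}, ∀ x ∈ A, 0 ≤ x := fun _ _ _ => zero_le
  have hne : ∀ n, f n ≠ [] := fun n hn =>
    hf.2 n (n + 1) n.lt_succ_self (le_of_entails (hS _) (hS _) (hn ▸ entails_nil _))
  have hdec : ∀ n, ∃ μ : Ordinal.{u}, ∃ h b : Worm.{u}, f n = h ++ μ :: b ∧ (∀ x ∈ h, μ < x) ∧
      ∀ x ∈ b, μ ≤ x := by
    intro n
    obtain ⟨μ, hμ, hle⟩ := exists_least (hne n)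
    obtain ⟨h, hh, h₁ | ⟨b, hb⟩⟩ := exists_isHead hle
    · exact absurd (hh μ (h₁ ▸ hμ)) (_root_.lt_irrefl _)
    · exact ⟨μ, h, b, hb, hh, fun x hx => hle x (by simp [hb, hx])⟩
  choose μ h b hfn hh hb using hdec
  obtain ⟨g₁, hg₁⟩ := exists_monotone_of_isMinBadSeq hf hmin h (fun n => by simp [hfn])
    (fun n => le_of_entails (hS _) (hS _) (hfn n ▸ append_entails_left _ _))
    (RelEmbedding.refl _)
  obtain ⟨g₂, hg₂⟩ := exists_monotone_of_isMinBadSeq hf hmin b (fun n => by simp [hfn]; omega)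
    (fun n => .inl ((hfn n ▸ append_entails_right (fun x hx => (hh n x hx).le) (b n) :
      Entails (f n) (μ n :: b n)).trans (entails_cons_of_le zero_le _)).lt) g₁
  obtain ⟨m, n, hmn, hμ⟩ : ∃ m n, m < n ∧ μ (g₁ (g₂ m)) ≤ μ (g₁ (g₂ n)) := by
    by_contra hcon
    push Not at hcon
    exact (RelEmbedding.natGT (r := (· < ·)) (fun n => μ (g₁ (g₂ n)))
      fun n => hcon _ _ n.lt_succ_self).not_wellFounded wellFounded_lt
  refine hf.2 _ _ (g₁.strictMono (g₂.strictMono hmn)) ?_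
  rw [hfn, hfn]
  exact append_le_append zero_le hμ (hh _) (hh _) (hb _) (hb _)
    (hg₁ _ _ (g₂.strictMono hmn)) (hg₂ _ _ hmn)

theorem wellFounded_lt (ξ : Ordinal.{u}) : WellFounded (lt ξ) := by
  refine Subrelation.wf (r := lt 0) (fun h => lt_mono_modality zero_le h) ?_
  have : IsStrictOrder Worm.{u} (lt 0) :=
    { irrefl := lt_irrefl 0, trans := fun _ _ _ => lt_trans }
  rw [RelEmbedding.wellFounded_iff_isEmpty]
  refine ⟨fun f => ?_⟩
  obtain ⟨m, n, hmn, h⟩ := (Set.partiallyWellOrderedOn_iff_exists_lt.1 partiallyWellOrderedOn_le) f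
    fun _ => trivial
  exact not_lt_of_le h (f.map_rel_iff.2 hmn)

end WellFounded

/-! ### Ranks and their reduction to modality zero. -/

section Rank

variable {ξ ζ : Ordinal.{u}}

theorem Omega_eq_rank (ξ : Ordinal.{u}) (A : Worm.{u}) :
    Omega ξ A = ((wellFounded_lt ξ).apply A).rank :=
  dif_pos _

theorem Omega_lt_Omega (h : lt ξ A B) : Omega ξ A < Omega ξ B := by
  rw [Omega_eq_rank, Omega_eq_rank]
  exact Acc.rank_lt_of_rel _ h

theorem Omega_le_of_forall {o : Ordinal.{u + 1}} (h : ∀ B, lt ξ B A → Omega ξ B < o) :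
    Omega ξ A ≤ o := by
  rw [Omega_eq_rank, Acc.rank_eq]
  refine Ordinal.iSup_le fun b => Order.succ_le_of_lt ?_
  have := h b.1 b.2
  rwa [Omega_eq_rank] at this

/-- A map that preserves the orders does not decrease ranks. -/
theorem Omega_le_Omega_map (f : Worm.{u} → Worm.{u}) (hf : ∀ B A, lt ξ B A → lt ζ (f B) (f A))
    (A : Worm.{u}) : Omega ξ A ≤ Omega ζ (f A) := by
  induction A using (wellFounded_lt ξ).induction with
  | _ A ih =>
    exact Omega_le_of_forall fun B hB => (ih B hB).trans_lt (Omega_lt_Omega (hf B A hB))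

theorem Omega_le_of_entails (h : Entails A B) : Omega ξ B ≤ Omega ξ A :=
  Omega_le_of_forall fun _ hC => Omega_lt_Omega (lt_of_entails_of_lt h hC)

theorem Omega_antitone (h : ξ ≤ ζ) (A : Worm.{u}) : Omega ζ A ≤ Omega ξ A :=
  Omega_le_Omega_map id (fun _ _ h' => lt_mono_modality h h') A

theorem equiv_of_Omega_eq (hA : ∀ x ∈ A, ξ ≤ x) (hB : ∀ x ∈ B, ξ ≤ x)
    (h : Omega ξ A = Omega ξ B) : equiv A B := by
  rcases trichotomy hA hB with h₁ | h₁ | h₁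
  · exact absurd h (Omega_lt_Omega h₁).ne
  · exact h₁
  · exact absurd h (Omega_lt_Omega h₁).ne'

theorem le_of_mem_head {x : Ordinal.{u}} (hx : x ∈ head ξ A) : ξ ≤ x := by
  simpa using List.mem_takeWhile_imp hx

theorem eq_head_append (ξ : Ordinal.{u}) (A : Worm.{u}) :
    A = head ξ A ∨ ∃ η < ξ, ∃ b, A = head ξ A ++ η :: b := by
  induction A with
  | nil => exact .inl rfl
  | cons x A ih =>
    by_cases hx : ξ ≤ x
    · have h : head ξ (x :: A) = x :: head ξ A := by simp [head, hx]
      rw [h]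
      simpa using ih
    · have h : head ξ (x :: A) = [] := by simp [head, hx]
      rw [h]
      exact .inr ⟨x, not_le.1 hx, A, rfl⟩

theorem entails_head (ξ : Ordinal.{u}) (A : Worm.{u}) : Entails A (head ξ A) := by
  rcases eq_head_append ξ A with h | ⟨η, -, b, h⟩
  · rw [← h]; exact .refl _
  · conv_lhs => rw [h]
    exact append_entails_left _ _

/-- A worm does not entail `⟨ξ⟩` of its own `ξ`-head. -/
theorem not_lt_head (ξ : Ordinal.{u}) (A : Worm.{u}) : ¬ lt ξ (head ξ A) A := by
  intro h
  rcases eq_head_append ξ A with h₁ | ⟨η, hη, b, h₁⟩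
  · rw [← h₁] at h
    exact lt_irrefl ξ A h
  · have h₂ : Entails A (η :: b) := by
      conv_lhs => rw [h₁]
      exact append_entails_right (fun x hx => hη.le.trans (le_of_mem_head hx)) b
    -- Reattaching the tail turns `⟨ξ⟩` of the head into `⟨ξ⟩A`.
    have h₃ : Entails A ((ξ :: head ξ A) ++ η :: b) := Entails.append
      (List.forall_mem_cons.2 ⟨hη, fun x hx => hη.trans_le (le_of_mem_head hx)⟩) h.entails h₂
    rw [List.cons_append, ← h₁] at h₃
    exact lt_irrefl ξ A h₃.lt

/-- The `ξ`-head of a worm, with `ξ` subtracted from all modalities. -/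
noncomputable def lowerHead (ξ : Ordinal.{u}) (A : Worm.{u}) : Worm.{u} :=
  (head ξ A).map (· - ξ)

theorem map_add_lowerHead (ξ : Ordinal.{u}) (A : Worm.{u}) :
    (lowerHead ξ A).map (ξ + ·) = head ξ A := by
  rw [lowerHead, List.map_map]
  conv_rhs => rw [← List.map_id (head ξ A)]
  exact List.map_congr_left fun x hx => Ordinal.add_sub_cancel_of_le (le_of_mem_head hx)

theorem strictMono_add (ξ : Ordinal.{u}) : StrictMono (ξ + ·) := fun _ _ h => by
  simpa using h

theorem lt_map_add (ξ : Ordinal.{u}) (h : lt 0 A B) : lt ξ (A.map (ξ + ·)) (B.map (ξ + ·)) := by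
  have := h.entails.map (strictMono_add ξ)
  simp only [List.map_cons, add_zero] at this
  exact this.lt

/-- If the head of `A` were `≤_ξ` that of `B`, then `A` would entail `⟨ξ⟩` of its own head.
Linearity of `<_0` on the lowered heads leaves only the desired case, so the shift need not be shown
to reflect provability. -/
theorem lt_lowerHead (h : lt ξ B A) : lt 0 (lowerHead ξ B) (lowerHead ξ A) := by
  have key : ¬ le ξ (head ξ A) (head ξ B) := fun h₁ => not_lt_head ξ A
    (Entails.lt (h.entails.trans (((entails_head ξ B).cons ξ).trans (cons_entails_of_le h₁))))
  rw [← map_add_lowerHead ξ A, ← map_add_lowerHead ξ B] at key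
  rcases trichotomy (α := 0) (A := lowerHead ξ B) (B := lowerHead ξ A) (fun _ _ => zero_le)
    (fun _ _ => zero_le) with h₁ | h₁ | h₁
  · exact h₁
  · exact absurd (.inr ((h₁.symm.entails.map (strictMono_add ξ)).equiv
      (h₁.entails.map (strictMono_add ξ)))) key
  · exact absurd (.inl (lt_map_add ξ h₁)) key

/-- Lowering the head and shifting back up both preserve the orders, so neither decreases rank. -/
theorem Omega_eq_Omega_lowerHead (ξ : Ordinal.{u}) (A : Worm.{u}) :
    Omega ξ A = Omega 0 (lowerHead ξ A) := by
  refine (Omega_le_Omega_map _ (fun _ _ => lt_lowerHead) A).antisymm ?_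
  refine (Omega_le_Omega_map (ζ := ξ) (List.map (ξ + ·)) (fun _ _ => lt_map_add ξ) _).trans ?_
  rw [map_add_lowerHead]
  exact Omega_le_of_entails (entails_head ξ A)

end Rank

end Worm
end GLP

namespace GLP

open Ordinal

/-! ### Partial sums of Cantor normal forms. -/

section CantorNormalForm

theorem sumOmegaPow_cons (ρ : Ordinal.{u}) (L : List Ordinal.{u}) :
    sumOmegaPow (ρ :: L) = ω ^ ρ + sumOmegaPow L := by
  simp [sumOmegaPow]

theorem sumOmegaPow_append (L M : List Ordinal.{u}) :
    sumOmegaPow (L ++ M) = sumOmegaPow L + sumOmegaPow M := by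
  simp [sumOmegaPow]

theorem sumOmegaPow_lt {ρ : Ordinal.{u}} {L : List Ordinal.{u}} (hL : ∀ x ∈ L, x ≤ ρ) :
    sumOmegaPow L < ω ^ Order.succ ρ := by
  induction L with
  | nil => simpa [sumOmegaPow] using opow_pos (Order.succ ρ) omega0_pos
  | cons x L ih =>
    rw [List.forall_mem_cons] at hL
    rw [sumOmegaPow_cons]
    exact isPrincipal_add_omega0_opow _
      ((opow_lt_opow_iff_right one_lt_omega0).2 (Order.lt_succ_of_le hL.1)) (ih hL.2)

theorem opow_le_sumOmegaPow {x : Ordinal.{u}} {L : List Ordinal.{u}} (hx : x ∈ L) :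
    ω ^ x ≤ sumOmegaPow L := by
  induction L with
  | nil => simp at hx
  | cons y L ih =>
    rw [sumOmegaPow_cons]
    rcases List.mem_cons.1 hx with rfl | hx
    · exact le_self_add
    · exact (ih hx).trans le_add_self

theorem exists_isCNF (α : Ordinal.{u}) : ∃ L, IsCNF L α := by
  induction α using WellFoundedLT.induction with
  | _ α ih =>
  by_cases hα : α = 0
  · exact ⟨[], by simp, by simp [hα, sumOmegaPow]⟩
  have hle := opow_log_le_self ω hα
  have hadd := Ordinal.add_sub_cancel_of_le hle
  have hsub : α - ω ^ log ω α < α := by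
    refine lt_of_le_of_ne (Ordinal.sub_le_self _ _) fun h => ?_
    rw [h] at hadd
    -- Absorbing the leading power would force `α ≥ ω^(log α + 1)`.
    have h₁ := add_eq_right_iff_mul_omega0_le.1 hadd
    rw [← opow_succ] at h₁
    exact h₁.not_gt (lt_opow_succ_log_self one_lt_omega0 α)
  obtain ⟨L, hL, hL'⟩ := ih _ hsub
  refine ⟨log ω α :: L, List.pairwise_cons.2 ⟨fun x hx => ?_, hL⟩, ?_⟩
  · exact (opow_le_iff_le_log one_lt_omega0 hα).1
      ((opow_le_sumOmegaPow hx).trans (hL'.le.trans hsub.le))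
  · rw [sumOmegaPow_cons, hL', hadd]

/-- `ω^ρ` is the last summand of `ζ`; the summands of `ξ` after it have exponents at most `ρ` and
add up to `δ`. -/
theorem exists_of_mem_CNA {ζ ξ : Ordinal.{u}} (hζ : ζ ≠ 0) (h : ζ ∈ CNA ξ) :
    ∃ ζ₀ ρ δ : Ordinal.{u}, ζ = ζ₀ + ω ^ ρ ∧ δ < ω ^ Order.succ ρ ∧ ξ = ζ + δ := by
  obtain ⟨L, ⟨hL, rfl⟩, k, -, rfl⟩ := h
  have hne : L.take k ≠ [] := by
    intro h
    simp [h, sumOmegaPow] at hζ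
  obtain ⟨M, ρ, hM⟩ : ∃ M ρ, L.take k = M ++ [ρ] :=
    ⟨_, _, (List.dropLast_append_getLast hne).symm⟩
  refine ⟨sumOmegaPow M, ρ, sumOmegaPow (L.drop k), ?_, sumOmegaPow_lt fun x hx => ?_, ?_⟩
  · rw [hM, sumOmegaPow_append]; simp [sumOmegaPow]
  · rw [← List.take_append_drop k L, List.pairwise_append] at hL
    exact hL.2.2 ρ (by simp [hM]) x hx
  · rw [← sumOmegaPow_append, List.take_append_drop]

theorem exists_forall_mem_CNA {ζ : Ordinal.{u}} (hζ : ζ ≠ 0) :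
    ∃ ζ₀ ρ : Ordinal.{u}, ζ = ζ₀ + ω ^ ρ ∧ ∀ δ < ω ^ Order.succ ρ, ζ ∈ CNA (ζ + δ) := by
  obtain ⟨L, hL, hLζ⟩ := exists_isCNF ζ
  have hne : L ≠ [] := by
    rintro rfl
    exact hζ (by simpa [sumOmegaPow] using hLζ.symm)
  obtain ⟨M, ρ, rfl⟩ : ∃ M ρ, L = M ++ [ρ] := ⟨_, _, (List.dropLast_append_getLast hne).symm⟩
  refine ⟨sumOmegaPow M, ρ, ?_, fun δ hδ => ?_⟩
  · rw [← hLζ, sumOmegaPow_append]; simp [sumOmegaPow]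
  · obtain ⟨N, hN, rfl⟩ := exists_isCNF δ
    refine ⟨(M ++ [ρ]) ++ N, ⟨List.pairwise_append.2 ⟨hL, hN, fun x hx y hy => ?_⟩, ?_⟩,
      (M ++ [ρ]).length, by simp, by rw [List.take_left, hLζ]⟩
    · have hy : y ≤ ρ := Order.lt_succ_iff.1 ((opow_lt_opow_iff_right one_lt_omega0).1
        ((opow_le_sumOmegaPow hy).trans_lt hδ))
      refine hy.trans ?_
      rcases List.mem_append.1 hx with hx | hx
      · exact (List.pairwise_append.1 hL).2.2 x hx ρ (by simp)
      · exact (List.mem_singleton.1 hx).ge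
    · rw [sumOmegaPow_append, hLζ]

theorem add_opow_eq_of_le {ζ₀ ξ ρ : Ordinal.{u}} (h₁ : ζ₀ ≤ ξ) (h₂ : ξ < ζ₀ + ω ^ ρ) :
    ξ + ω ^ ρ = ζ₀ + ω ^ ρ := by
  obtain ⟨δ, rfl⟩ := exists_add_of_le h₁
  rw [add_assoc, add_omega0_opow ((add_lt_add_iff_left ζ₀).1 h₂)]

end CantorNormalForm

/-! ### Normal forms, behaviour below a limit, and the equivalence. -/

namespace Worm

variable {A B : Worm.{u}} {α ζ ξ : Ordinal.{u}}

theorem head_eq_self (h : ∀ x ∈ A, ζ ≤ x) : head ζ A = A := by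
  rw [head, List.takeWhile_eq_self_iff]
  simpa using h

theorem head_append_cons (X r : Worm.{u}) (h : α < ζ) : head ζ (X ++ α :: r) = head ζ X := by
  induction X with
  | nil => simp [head, h]
  | cons x X ih =>
    simp only [head] at ih
    by_cases hx : ζ ≤ x <;> simp [head, hx, ih]

theorem IsBNF.head (hA : IsBNF A) (ζ : Ordinal.{u}) : IsBNF (head ζ A) := by
  induction hA with
  | nil => exact .nil
  | join α L hne hmin hS hBNF hchain ih =>
    by_cases hζ : ζ ≤ α
    · rw [head_eq_self fun x hx => hζ.trans (hmin.2 hx)]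
      exact .join α L hne hmin hS hBNF hchain
    · match L, hne with
      | [X], _ =>
        rw [List.intercalate_singleton]
        exact ih X (by simp)
      | X :: Y :: L, _ =>
        rw [List.intercalate_cons_cons, List.append_assoc, List.singleton_append,
          head_append_cons _ _ (not_le.1 hζ)]
        exact ih X (by simp)

theorem cons_intercalate_entails (L : List Worm.{u}) (hne : L ≠ [])
    (hS : ∀ X ∈ L, ∀ x ∈ X, α < x) :
    Entails (α :: List.intercalate [α] L) (α :: L.getLast hne) := by
  induction L with
  | nil => exact absurd rfl hne
  | cons X L ih =>
    cases L with
    | nil => simpa using Entails.refl _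
    | cons Y L =>
      rw [List.forall_mem_cons] at hS
      rw [List.intercalate_cons_cons, List.append_assoc, List.singleton_append,
        List.getLast_cons (by simp)]
      exact (((append_entails_right (fun x hx => (hS.1 x hx).le) _).cons α).trans
        (cons_cons_entails le_rfl _)).trans (ih (by simp) hS.2)

theorem le_getLast_of_isChain (L : List Worm.{u}) (hne : L ≠ []) (hL : L.IsChain (le α)) :
    ∀ X ∈ L, le α X (L.getLast hne) := by
  induction L with
  | nil => exact absurd rfl hne
  | cons X L ih =>
    cases L with
    | nil => simpa using .inr (equiv_refl _)
    | cons Y L =>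
      rw [List.isChain_cons_cons] at hL
      rw [List.getLast_cons (by simp)]
      have h := ih (by simp) hL.2
      exact List.forall_mem_cons.2 ⟨le_trans hL.1 (h Y (by simp)), h⟩

/-- Built from the right: each block is below `B` at `α + 1`, and the part after it need only be
below `B` at `α`. -/
theorem intercalate_lt {Z : Worm.{u}} (hZ : lt (α + 1) Z B) (L : List Worm.{u}) (hne : L ≠ [])
    (hS : ∀ X ∈ L, ∀ x ∈ X, α < x) (hL : ∀ X ∈ L, le (α + 1) X Z) :
    lt (α + 1) (List.intercalate [α] L) B := by
  induction L with
  | nil => exact absurd rfl hne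
  | cons X L ih =>
    rw [List.forall_mem_cons] at hS hL
    have hX : lt (α + 1) X B := (hZ.entails.trans (cons_entails_of_le hL.1)).lt
    cases L with
    | nil => rwa [List.intercalate_singleton]
    | cons Y L =>
      rw [List.intercalate_cons_cons, List.append_assoc, List.singleton_append]
      refine IsHead.lt_of_lt ⟨hS.1, .inr ⟨_, rfl⟩⟩ hX fun b hb => ?_
      obtain rfl : List.intercalate [α] (Y :: L) = b := by simpa using hb
      exact lt_mono_modality (Order.le_succ α) (ih (by simp) hS.2 hL.2)

/-- A nonempty worm in normal form with least modality `μ` is not equivalent to any worm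
of `S_{μ+1}`. -/
theorem IsBNF.not_equiv {μ : Ordinal.{u}} (hA : IsBNF A) (hμ : IsLeast {β | β ∈ A} μ)
    (hB : ∀ x ∈ B, μ < x) : ¬ equiv A B := by
  intro heq
  rcases hA with _ | ⟨α, L, hne, hmin, hS, -, hchain⟩
  · simpa using hμ.1
  obtain rfl := hmin.unique hμ
  replace hS : ∀ X ∈ L, ∀ x ∈ X, α < x := fun X hX x hx => Order.add_one_le_iff.1 (hS X hX x hx)
  have hZB : lt α (L.getLast hne) B := by
    match L, hne with
    | [X], _ =>
      rw [List.intercalate_singleton] at hmin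
      exact absurd (hS X (by simp) α hmin.1) (_root_.lt_irrefl _)
    | X :: Y :: L, _ =>
      rw [List.forall_mem_cons] at hS
      rw [List.intercalate_cons_cons, List.append_assoc, List.singleton_append] at heq
      rw [List.getLast_cons (by simp)]
      exact ((heq.symm.entails.trans (append_entails_right (fun x hx => (hS.1 x hx).le) _)).trans
        (cons_intercalate_entails _ (by simp) hS.2)).lt
  -- Both worms lie in `S_{α+1}`, so linearity upgrades `<_α` to `<_{α+1}`. The last block is the
  -- greatest, hence `B` entails `⟨α+1⟩A`, which contradicts `A ↔ B`.
  have hZB' : lt (α + 1) (L.getLast hne) B := by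
    have hle : α ≤ α + 1 := Order.le_succ α
    rcases trichotomy (α := α + 1) (A := L.getLast hne) (B := B)
      (fun x hx => Order.add_one_le_iff.2 (hS _ (List.getLast_mem hne) x hx))
      (fun x hx => Order.add_one_le_iff.2 (hB x hx)) with h | h | h
    · exact h
    · exact absurd hZB (not_lt_of_le (.inr h.symm))
    · exact absurd hZB (not_lt_of_le (.inl (lt_mono_modality hle h)))
  exact not_lt_of_le (.inr heq.symm)
    (intercalate_lt hZB' L hne hS (le_getLast_of_isChain L hne hchain))

/-- It suffices that `ξ` exceed the first letter of `A` below `ζ`. -/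
theorem exists_head_eq (hζ : Order.IsSuccLimit ζ) (A : Worm.{u}) :
    ∃ ξ₀ < ζ, ∀ ξ, ξ₀ ≤ ξ → ξ < ζ → head ξ A = head ζ A := by
  induction A with
  | nil => exact ⟨0, hζ.bot_lt, fun _ _ _ => rfl⟩
  | cons x A ih =>
    by_cases hx : ζ ≤ x
    · obtain ⟨ξ₀, h₀, h⟩ := ih
      refine ⟨ξ₀, h₀, fun ξ h₁ h₂ => ?_⟩
      have := h ξ h₁ h₂
      simp only [head] at this
      simp [head, hx, h₂.le.trans hx, this]
    · refine ⟨Order.succ x, hζ.succ_lt (not_le.1 hx), fun ξ h₁ _ => ?_⟩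
      have : ¬ ξ ≤ x := not_le.2 (Order.succ_le_iff.1 h₁)
      simp [head, hx, this]

/-- For arbitrarily large `ξ` below `ζ = ζ₀ + ω ^ ρ`, lowering the `ξ`-head amounts to lowering the
`ζ`-head and raising the result by `ω ^ ρ`. -/
theorem exists_lowerHead {ζ₀ ρ : Ordinal.{u}} (hζ : Order.IsSuccLimit ζ) (hρ : ζ = ζ₀ + ω ^ ρ)
    (A : Worm.{u}) {η : Ordinal.{u}} (hη : η < ζ) :
    ∃ ξ, η ≤ ξ ∧ ξ < ζ ∧ lowerHead ξ A = (lowerHead ζ A).map (ω ^ ρ + ·) := by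
  obtain ⟨ξ₀, h₀, h⟩ := exists_head_eq hζ A
  have hζ₀ : ζ₀ < ζ := by
    rw [hρ]
    exact lt_add_of_pos_right _ (opow_pos _ omega0_pos)
  -- `ξ₀` fixes the head; `ζ₀` makes `ω^ρ` absorb what `ξ` has beyond `ζ₀`, so `ξ + ω^ρ = ζ`.
  set ξ := max η (max ξ₀ ζ₀) with hξ
  have hξζ : ξ < ζ := max_lt hη (max_lt h₀ hζ₀)
  have hadd : ξ + ω ^ ρ = ζ := by
    rw [hρ]
    exact add_opow_eq_of_le ((le_max_right _ _).trans (le_max_right _ _)) (hρ ▸ hξζ)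
  refine ⟨ξ, le_max_left _ _, hξζ, ?_⟩
  rw [lowerHead, h ξ ((le_max_left _ _).trans (le_max_right _ _)) hξζ, lowerHead, List.map_map]
  refine List.map_congr_left fun x hx => ?_
  obtain ⟨δ, rfl⟩ := exists_add_of_le (le_of_mem_head hx)
  rw [Function.comp_apply, Ordinal.add_sub_cancel, ← hadd, add_assoc, Ordinal.add_sub_cancel]

theorem change_of_mem_CNA (hζ : Order.IsSuccLimit ζ) (hA : IsBNF A) (hξ : ξ ∈ head ζ A)
    (h : ζ ∈ CNA ξ) : Change ζ A := by
  obtain ⟨ζ₀, ρ, δ, hρ, hδ, rfl⟩ := exists_of_mem_CNA hζ.bot_lt.ne' h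
  -- As `Ω_ξ(A)` is antitone in `ξ`, it is constant from a minimizing `ξ₀` up to `ζ`; only a strict
  -- drop at `ζ` remains to be shown.
  obtain ⟨ξ₀, h₀, hmin⟩ := WellFounded.has_min (InvImage.wf (fun ξ => Omega ξ A)
    (_root_.wellFounded_lt (α := Ordinal.{u + 1}))) {ξ | ξ < ζ} ⟨0, hζ.bot_lt⟩
  have hmin' : ∀ η < ζ, Omega ξ₀ A ≤ Omega η A := fun η hη => not_lt.1 (hmin η hη)
  refine ⟨ξ₀, h₀, lt_of_le_of_ne (Omega_antitone (le_of_lt h₀) A) fun heq => ?_,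
    fun η h₁ h₂ => (hmin' η h₂).antisymm (Omega_antitone h₁ A)⟩
  obtain ⟨ξ, h₁, h₂, h₃⟩ := exists_lowerHead hζ hρ A h₀
  have heq' : Omega ξ A = Omega ζ A :=
    ((Omega_antitone h₁ A).trans heq.ge).antisymm (Omega_antitone h₂.le A)
  rw [Omega_eq_Omega_lowerHead, Omega_eq_Omega_lowerHead ζ, h₃] at heq'
  have hequiv := equiv_of_Omega_eq (fun _ _ => zero_le) (fun _ _ => zero_le) heq'
  -- Shifting up by `ζ` restores the `ζ`-head, to which the normal form hypothesis applies.
  replace hequiv := (hequiv.symm.entails.map (strictMono_add ζ)).equiv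
    (hequiv.entails.map (strictMono_add ζ))
  rw [map_add_lowerHead] at hequiv
  obtain ⟨μ, hμ, hle⟩ := exists_least (List.ne_nil_of_mem hξ)
  refine (hA.head ζ).not_equiv ⟨hμ, hle⟩ (fun x hx => ?_) hequiv
  obtain ⟨γ, hγ⟩ := exists_add_of_le (le_of_mem_head hμ)
  simp only [lowerHead, List.map_map, List.mem_map, Function.comp_apply] at hx
  obtain ⟨y, hy, rfl⟩ := hx
  have hγδ : γ ≤ δ := by
    have := hle _ hξ
    rwa [hγ, add_le_add_iff_left] at this
  have hγy : γ ≤ y - ζ := by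
    have := hle _ hy
    rwa [hγ, ← Ordinal.add_sub_cancel_of_le (le_of_mem_head hy), add_le_add_iff_left] at this
  rw [hγ]
  refine (add_lt_add_iff_left ζ).2 (lt_of_lt_of_le ?_ (add_le_add_right hγy _))
  -- The least letter is `ζ + γ` with `γ ≤ δ < ω^(ρ+1)`, so `ω^ρ + γ` cannot collapse to `γ`.
  refine lt_of_le_of_ne le_add_self fun h => ?_
  have := add_eq_right_iff_mul_omega0_le.1 h.symm
  rw [← opow_succ] at this
  exact (this.trans hγδ).not_gt hδ

theorem exists_mem_CNA_of_change (hζ : Order.IsSuccLimit ζ) (h : Change ζ A) :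
    ∃ ξ ∈ head ζ A, ζ ∈ CNA ξ := by
  by_contra hcon
  push Not at hcon
  obtain ⟨ξ₀, h₀, hlt, hconst⟩ := h
  obtain ⟨ζ₀, ρ, hρ, hmem⟩ := exists_forall_mem_CNA hζ.bot_lt.ne'
  obtain ⟨ξ, h₁, h₂, h₃⟩ := exists_lowerHead hζ hρ A h₀
  refine hlt.ne' ?_
  rw [hconst ξ h₁ h₂, Omega_eq_Omega_lowerHead, Omega_eq_Omega_lowerHead ζ, h₃]
  congr 1
  conv_rhs => rw [← List.map_id (lowerHead ζ A)]
  refine List.map_congr_left fun x hx => ?_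
  obtain ⟨y, hy, rfl⟩ := List.mem_map.1 hx
  obtain ⟨δ, rfl⟩ := exists_add_of_le (le_of_mem_head hy)
  rw [Ordinal.add_sub_cancel]
  refine add_eq_right_iff_mul_omega0_le.2 ?_
  rw [← opow_succ]
  exact not_lt.1 fun hδ => hcon _ hy (hmem δ hδ)

end Worm

end GLP

theorem mainTheorem5 (ζ : Ordinal.{u}) (hζ : Order.IsSuccLimit ζ)
    (A : GLP.Worm.{u}) (hA : GLP.Worm.IsBNF A) :
    (∀ ξ : Ordinal.{u}, WellFounded (GLP.Worm.lt ξ)) ∧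
      (GLP.Worm.Change ζ A ↔ ∃ ξ ∈ GLP.Worm.head ζ A, ζ ∈ GLP.CNA ξ) :=
  ⟨GLP.Worm.wellFounded_lt, GLP.Worm.exists_mem_CNA_of_change hζ,
    fun ⟨_, hξ, h⟩ => GLP.Worm.change_of_mem_CNA hζ hA hξ h⟩
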